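/- Let $p\ge 3$ be an integer. For $\theta\in\mathbb{R}^p$ let $X\sim\mathcal{N}_p(\theta,I_p)$, and for an estimator $\hat\theta:\mathbb{R}^p\to\mathbb{R}^p$ let $$R(\theta,\hat\theta)=\mathrm{E}\bigl[\|\hat\theta(X)-\theta\|^2\bigr]$$ be its risk under quadratic loss, where $\|\cdot\|$ is the Euclidean norm. Let $$\hat\theta_{\mathrm{JS}}(x)=\Bigl(1-\frac{p-2}{\|x\|^2}\Bigr)x,\qquad \hat\theta_{\mathrm{JS}}^+(x)=\max\Bigl(0,\,1-\frac{p-2}{\|x\|^2}\Bigr)x$$ be the James–Stein estimator and the positive-part James–Stein estimator (both set equal to $0$ at $x=0$). Then both risks $R(\theta,\hat\theta_{\mathrm{JS}})$ and $R(\theta,\hat\theta_{\mathrm{JS}}^+)$ are finite for every $\theta\in\mathbb{R}^p$ and, with $\nu=\|\theta\|^2$, $$\lim_{\nu\to\infty}\frac{\nu^{(p+1)/4}\,e^{\nu/2}}{e^{\sqrt{\nu}\sqrt{p-2}}}\Bigl\{R(\theta,\hat\theta_{\mathrm{JS}})-R(\theta,\hat\theta_{\mathrm{JS}}^+)\Bigr\}=4\,\frac{(p-2)^{(p-1)/4}}{\sqrt{2\pi}\,\exp(p/2-1)},$$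 where the limit is taken over $\theta\in\mathbb{R}^p$ with $\|\theta\|^2\to\infty$ (uniformly in the direction of $\theta$). -/

import Mathlib

open MeasureTheory ProbabilityTheory Filter Topology

noncomputable section

/-- The James-Stein estimator `(1 - (p - 2) / ‖x‖²) x` of a `p`-dimensional mean vector. -/
def jamesStein (p : ℕ) (x : EuclideanSpace ℝ (Fin p)) : EuclideanSpace ℝ (Fin p) :=
  (1 - ((p : ℝ) - 2) / ‖x‖ ^ 2) • x

/-- The positive-part James-Stein estimator `max (0, 1 - (p - 2) / ‖x‖²) x`. -/
def jamesSteinPos (p : ℕ) (x : EuclideanSpace ℝ (Fin p)) : EuclideanSpace ℝ (Fin p) :=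
  max 0 (1 - ((p : ℝ) - 2) / ‖x‖ ^ 2) • x

/-- The quadratic loss `‖d - θ‖²`. -/
def quadLoss {p : ℕ} (θ d : EuclideanSpace ℝ (Fin p)) : ℝ :=
  ‖d - θ‖ ^ 2

/-- The risk `E ‖δ(X) - θ‖²` of the estimator `δ` at `θ`, where `X` has the normal distribution
with mean `θ` and identity covariance matrix. -/
def quadRisk {p : ℕ} (θ : EuclideanSpace ℝ (Fin p))
    (δ : EuclideanSpace ℝ (Fin p) → EuclideanSpace ℝ (Fin p)) : ℝ :=
  ∫ x, quadLoss θ (δ x) ∂(multivariateGaussian θ (1 : Matrix (Fin p) (Fin p) ℝ))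

end

/-! The two estimators differ only on the ball `‖x‖² < b²`, `b² = p - 2`, where the positive part is
`0`. Up to the factor `(2π)^(-p/2) exp(-‖θ‖²/2)`, the risk difference is therefore the integral over
this ball of `lossKernel`, which contains `exp ⟪x, θ⟫` (`quadRisk_jamesStein_sub`).

Put `t = ‖θ‖`. The exponential peaks at the boundary point `bθ/t`, so Laplace's method applies.
Rotate `θ` onto the first axis and write `x = (b - s/t, z/√t)`. The Jacobian is `t^(-(p+1)/2)`, and
`exp(-bt)` times the kernel tends to `(2/b) max(2bs - ‖z‖², 0) exp(-b²/2 - s)`, whose integral is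
explicit (`tendsto_outer_integral`). Domination holds on the shell `b²/4 ≤ ‖x‖² < b²`. The inner
ball, where the kernel may be singular, contributes only `O((1 + t) exp(bt/2))`
(`tendsto_inner_integral`). -/

/-! ### The Gaussian density. -/

theorem integrable_gaussian_sq_norm {V : Type*} [NormedAddCommGroup V] [InnerProductSpace ℝ V]
    [FiniteDimensional ℝ V] [MeasurableSpace V] [BorelSpace V] {c : ℝ} (hc : 0 < c) :
    Integrable fun x : V => Real.exp (-c * ‖x‖ ^ 2) := by
  have := (GaussianFourier.integrable_cexp_neg_mul_sq_norm_add (V := V) (b := c)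
    (by simpa using hc) 0 0).re
  refine this.congr (Eventually.of_forall fun x => ?_)
  simp only [zero_mul, add_zero, RCLike.re_eq_complex_re]
  rw [show (-(c : ℂ) * (‖x‖ : ℂ) ^ 2) = ((-c * ‖x‖ ^ 2 : ℝ) : ℂ) by push_cast; ring,
    Complex.exp_ofReal_re]

/-- Finite measures are determined by their characteristic functions; that of the right side is a
Gaussian Fourier integral. -/
theorem stdGaussian_eq_withDensity (V : Type*) [NormedAddCommGroup V] [InnerProductSpace ℝ V]
  [FiniteDimensional ℝ V] [MeasurableSpace V] [BorelSpace V] :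
    stdGaussian V = volume.withDensity (fun x : V => ENNReal.ofReal
      ((2 * Real.pi) ^ (-(Module.finrank ℝ V : ℝ) / 2) * Real.exp (-‖x‖ ^ 2 / 2))) := by
  have hint : Integrable (fun x : V =>
      (2 * Real.pi) ^ (-(Module.finrank ℝ V : ℝ) / 2) * Real.exp (-‖x‖ ^ 2 / 2)) := by
    refine Integrable.const_mul ?_ _
    refine (integrable_gaussian_sq_norm (V := V) (c := 1 / 2) (by norm_num)).congr
      (Eventually.of_forall fun x => ?_)
    simp only
    congr 1
    ring
  have : IsFiniteMeasure (volume.withDensity (fun x : V => ENNReal.ofReal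
      ((2 * Real.pi) ^ (-(Module.finrank ℝ V : ℝ) / 2) * Real.exp (-‖x‖ ^ 2 / 2)))) :=
    isFiniteMeasure_withDensity_ofReal hint.2
  apply Measure.ext_of_charFun
  ext w
  rw [charFun_stdGaussian, charFun_apply, integral_withDensity_eq_integral_toReal_smul₀
    (by fun_prop) (by simp)]
  have h := GaussianFourier.integral_cexp_neg_mul_sq_norm_add (V := V) (b := 1 / 2)
    (by norm_num) Complex.I w
  have h2 : ∀ x : V, (ENNReal.ofReal ((2 * Real.pi) ^ (-(Module.finrank ℝ V : ℝ) / 2) *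
      Real.exp (-‖x‖ ^ 2 / 2))).toReal • Complex.exp ((inner ℝ x w : ℝ) * Complex.I) =
      (((2 * Real.pi) ^ (-(Module.finrank ℝ V : ℝ) / 2) : ℝ) : ℂ) *
        Complex.exp (-(1 / 2) * (‖x‖ : ℂ) ^ 2 + Complex.I * (inner ℝ w x : ℝ)) := by
    intro x
    rw [ENNReal.toReal_ofReal (by positivity), Complex.real_smul, Complex.ofReal_mul, mul_assoc,
      Complex.ofReal_exp, ← Complex.exp_add, real_inner_comm]
    congr 2
    push_cast
    ring
  simp_rw [h2]
  rw [integral_const_mul]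
  rw [h, Complex.I_sq, show (Real.pi / (1 / 2) : ℂ) = ((2 * Real.pi : ℝ) : ℂ) by push_cast; ring,
    show ((Module.finrank ℝ V : ℂ) / 2) = (((Module.finrank ℝ V : ℝ) / 2 : ℝ) : ℂ) by
      push_cast; ring,
    ← Complex.ofReal_cpow (by positivity), ← mul_assoc, ← Complex.ofReal_mul,
    ← Real.rpow_add (by positivity),
    show -(Module.finrank ℝ V : ℝ) / 2 + (Module.finrank ℝ V : ℝ) / 2 = 0 by ring]
  simp
  norm_num

section Gaussian

variable {p : ℕ} (θ : EuclideanSpace ℝ (Fin p))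

theorem multivariateGaussian_one_eq_map :
    multivariateGaussian θ (1 : Matrix (Fin p) (Fin p) ℝ) =
      (stdGaussian (EuclideanSpace ℝ (Fin p))).map (MeasurableEquiv.addLeft θ) := by
  simp [multivariateGaussian]

/-- The normal density with identity covariance matrix. -/
noncomputable def gaussianDensity (x : EuclideanSpace ℝ (Fin p)) : ℝ :=
  (2 * Real.pi) ^ (-(p : ℝ) / 2) * Real.exp (-‖x - θ‖ ^ 2 / 2)

theorem continuous_gaussianDensity : Continuous (gaussianDensity θ) := by
  unfold gaussianDensity
  fun_prop

theorem gaussianDensity_nonneg (x : EuclideanSpace ℝ (Fin p)) : 0 ≤ gaussianDensity θ x := by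
  unfold gaussianDensity
  positivity

theorem gaussianDensity_le (x : EuclideanSpace ℝ (Fin p)) :
    gaussianDensity θ x ≤ (2 * Real.pi) ^ (-(p : ℝ) / 2) := by
  unfold gaussianDensity
  refine mul_le_of_le_one_right (by positivity) (Real.exp_le_one_iff.2 ?_)
  have := sq_nonneg ‖x - θ‖
  linarith

theorem multivariateGaussian_one_eq_withDensity :
    multivariateGaussian θ (1 : Matrix (Fin p) (Fin p) ℝ) =
      volume.withDensity (fun x => ENNReal.ofReal (gaussianDensity θ x)) := by
  rw [multivariateGaussian_one_eq_map, stdGaussian_eq_withDensity]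
  ext s hs
  rw [MeasurableEquiv.map_apply, withDensity_apply _ hs,
    withDensity_apply _ ((MeasurableEquiv.addLeft θ).measurable hs)]
  have hmp : MeasurePreserving (MeasurableEquiv.addLeft θ)
      (volume : Measure (EuclideanSpace ℝ (Fin p))) volume := measurePreserving_add_left volume θ
  rw [← hmp.setLIntegral_comp_preimage_emb (MeasurableEquiv.measurableEmbedding _)
    (fun x => ENNReal.ofReal (gaussianDensity θ x))]
  simp [gaussianDensity]

theorem integral_multivariateGaussian_one (f : EuclideanSpace ℝ (Fin p) → ℝ) :
    ∫ x, f x ∂(multivariateGaussian θ (1 : Matrix (Fin p) (Fin p) ℝ)) =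
      ∫ x, gaussianDensity θ x * f x := by
  rw [multivariateGaussian_one_eq_withDensity, integral_withDensity_eq_integral_toReal_smul₀
    (continuous_gaussianDensity θ).measurable.ennreal_ofReal.aemeasurable (by simp)]
  simp [ENNReal.toReal_ofReal (gaussianDensity_nonneg θ _)]

theorem integrable_multivariateGaussian_one_iff (f : EuclideanSpace ℝ (Fin p) → ℝ) :
    Integrable f (multivariateGaussian θ (1 : Matrix (Fin p) (Fin p) ℝ)) ↔
      Integrable (fun x => gaussianDensity θ x * f x) := by
  rw [multivariateGaussian_one_eq_withDensity, integrable_withDensity_iff_integrable_smul₀'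
    (continuous_gaussianDensity θ).measurable.ennreal_ofReal.aemeasurable (by simp)]
  simp [ENNReal.toReal_ofReal (gaussianDensity_nonneg θ _)]

end Gaussian

/-! ### Finiteness of the risks. -/

/-- In polar coordinates the integrand is `y^(p-1) / y² = y^(p-3)`, a nonnegative power because `p ≥
3`. -/
theorem integrableOn_ball_inv_sq_norm {p : ℕ} (hp : 3 ≤ p) (R : ℝ) :
    IntegrableOn (fun x : EuclideanSpace ℝ (Fin p) => (‖x‖ ^ 2)⁻¹) (Metric.ball 0 R) := by
  have : Nontrivial (EuclideanSpace ℝ (Fin p)) :=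
    Module.nontrivial_of_finrank_pos (R := ℝ) (by simp; omega)
  rw [integrableOn_fun_norm_addHaar volume (f := fun y => (y ^ 2)⁻¹)]
  have h : IntegrableOn (fun y : ℝ => y ^ (p - 3)) (Set.Ioo 0 R) :=
    ((continuous_pow (p - 3)).continuousOn.integrableOn_Icc (a := 0) (b := R)).mono_set
      Set.Ioo_subset_Icc_self
  refine h.congr_fun (fun y hy => ?_) measurableSet_Ioo
  obtain ⟨k, rfl⟩ := Nat.exists_eq_add_of_le hp
  have := hy.1.ne'
  simp only [finrank_euclideanSpace, Fintype.card_fin, smul_eq_mul]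
  rw [show 3 + k - 3 = k by omega, show 3 + k - 1 = k + 2 by omega, pow_add]
  field_simp

theorem integrable_inv_sq_norm_multivariateGaussian {p : ℕ} (hp : 3 ≤ p)
    (θ : EuclideanSpace ℝ (Fin p)) :
    Integrable (fun x => (‖x‖ ^ 2)⁻¹) (multivariateGaussian θ (1 : Matrix (Fin p) (Fin p) ℝ)) := by
  have h1 : Integrable (fun _ : EuclideanSpace ℝ (Fin p) => (1 : ℝ))
      (multivariateGaussian θ (1 : Matrix (Fin p) (Fin p) ℝ)) := integrable_const _
  have h2 : Integrable (fun x : EuclideanSpace ℝ (Fin p) =>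
      (Metric.ball 0 1).indicator (fun x => (‖x‖ ^ 2)⁻¹) x)
      (multivariateGaussian θ (1 : Matrix (Fin p) (Fin p) ℝ)) := by
    rw [integrable_multivariateGaussian_one_iff]
    refine Integrable.bdd_mul (c := (2 * Real.pi) ^ (-(p : ℝ) / 2))
      ((integrable_indicator_iff measurableSet_ball).2 (integrableOn_ball_inv_sq_norm hp 1))
      (continuous_gaussianDensity θ).aestronglyMeasurable (Eventually.of_forall fun x => ?_)
    rw [Real.norm_of_nonneg (gaussianDensity_nonneg θ x)]
    exact gaussianDensity_le θ x
  refine (h1.add h2).mono' (by fun_prop) (Eventually.of_forall fun x => ?_)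
  rw [Real.norm_of_nonneg (by positivity)]
  by_cases hx : x ∈ Metric.ball (0 : EuclideanSpace ℝ (Fin p)) 1
  · simp [hx]
  · simp only [Pi.add_apply, Set.indicator_of_notMem hx, add_zero]
    simp only [Metric.mem_ball, dist_zero_right, not_lt] at hx
    exact inv_le_one_of_one_le₀ (one_le_pow₀ hx)

/-- Serves both estimators: with `a = p - 2`, `‖g x • x‖²` is at most `‖x‖² - 2a + a²/‖x‖²` for `x ≠
0`. -/
theorem integrable_quadLoss_smul {p : ℕ} (hp : 3 ≤ p) (θ : EuclideanSpace ℝ (Fin p))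
    (g : EuclideanSpace ℝ (Fin p) → ℝ) (hg : Measurable g)
    (hle : ∀ x, |g x| ≤ |1 - ((p : ℝ) - 2) / ‖x‖ ^ 2|) :
    Integrable (fun x => quadLoss θ (g x • x))
      (multivariateGaussian θ (1 : Matrix (Fin p) (Fin p) ℝ)) := by
  have h1 : Integrable (fun x : EuclideanSpace ℝ (Fin p) => ‖x‖ ^ 2)
      (multivariateGaussian θ (1 : Matrix (Fin p) (Fin p) ℝ)) :=
    (IsGaussian.memLp_two_id (μ := multivariateGaussian θ (1 : Matrix (Fin p) (Fin p) ℝ))).integrable_norm_pow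
      (by norm_num)
  have h2 := (integrable_inv_sq_norm_multivariateGaussian hp θ).const_mul (((p : ℝ) - 2) ^ 2)
  refine (((h1.add h2).add (integrable_const (‖θ‖ ^ 2))).const_mul 2).mono' ?_
    (Eventually.of_forall fun x => ?_)
  · unfold quadLoss
    exact Measurable.aestronglyMeasurable (by fun_prop)
  have hpp : (0 : ℝ) < (p : ℝ) - 2 := by
    have : (3 : ℝ) ≤ p := by exact_mod_cast hp
    linarith
  unfold quadLoss
  rw [Real.norm_of_nonneg (by positivity)]
  have h3 : ‖g x • x‖ ^ 2 ≤ ‖x‖ ^ 2 + ((p : ℝ) - 2) ^ 2 * (‖x‖ ^ 2)⁻¹ := by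
    rcases eq_or_ne x 0 with rfl | hx
    · simp
    have hx' : 0 < ‖x‖ := norm_pos_iff.2 hx
    rw [norm_smul, Real.norm_eq_abs, mul_pow]
    calc |g x| ^ 2 * ‖x‖ ^ 2 ≤ |1 - ((p : ℝ) - 2) / ‖x‖ ^ 2| ^ 2 * ‖x‖ ^ 2 := by
          gcongr ?_ ^ 2 * _
          exact hle x
      _ = ‖x‖ ^ 2 + ((p : ℝ) - 2) ^ 2 * (‖x‖ ^ 2)⁻¹ - 2 * ((p : ℝ) - 2) := by
          rw [sq_abs]
          field_simp
          ring
      _ ≤ _ := by linarith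
  have h4 : ‖g x • x - θ‖ ^ 2 ≤ 2 * (‖g x • x‖ ^ 2 + ‖θ‖ ^ 2) := by
    have := norm_sub_le (g x • x) θ
    have h5 := norm_nonneg (g x • x - θ)
    nlinarith [sq_nonneg (‖g x • x‖ - ‖θ‖)]
  simp only [Pi.add_apply]
  linarith

theorem integrable_quadLoss_jamesStein {p : ℕ} (hp : 3 ≤ p) (θ : EuclideanSpace ℝ (Fin p)) :
    Integrable (fun x => quadLoss θ (jamesStein p x))
      (multivariateGaussian θ (1 : Matrix (Fin p) (Fin p) ℝ)) :=
  integrable_quadLoss_smul hp θ (fun x => 1 - ((p : ℝ) - 2) / ‖x‖ ^ 2) (by fun_prop)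
    fun _ => le_rfl

theorem integrable_quadLoss_jamesSteinPos {p : ℕ} (hp : 3 ≤ p) (θ : EuclideanSpace ℝ (Fin p)) :
    Integrable (fun x => quadLoss θ (jamesSteinPos p x))
      (multivariateGaussian θ (1 : Matrix (Fin p) (Fin p) ℝ)) :=
  integrable_quadLoss_smul hp θ (fun x => max 0 (1 - ((p : ℝ) - 2) / ‖x‖ ^ 2)) (by fun_prop)
    fun x => by
      rw [abs_of_nonneg (le_max_left _ _)]
      exact max_le (abs_nonneg _) (le_abs_self _)

/-! ### The loss kernel. -/

/-- The difference of the losses of the James-Stein estimator and its positive part, times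
`exp (-‖x - θ‖² / 2 + ‖θ‖² / 2)`, as a function of `r = ‖x‖²` and `m = ⟪x, θ⟫`, where
`‖x‖² < a = p - 2`. -/
noncomputable def lossKernel (a r m : ℝ) : ℝ :=
  ((1 - a / r) ^ 2 * r - 2 * (1 - a / r) * m) * Real.exp (-r / 2 + m)

@[fun_prop]
theorem measurable_indicator_lossKernel {α : Type*} [MeasurableSpace α] {s : Set ℝ}
    (hs : MeasurableSet s) (a : ℝ) {r m : α → ℝ} (hr : Measurable r) (hm : Measurable m) :
    Measurable fun x => s.indicator (fun r => lossKernel a r (m x)) (r x) := by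
  have : (fun x => s.indicator (fun r => lossKernel a r (m x)) (r x)) =
      (r ⁻¹' s).indicator (fun x => lossKernel a (r x) (m x)) := by
    ext x
    by_cases h : r x ∈ s
    · rw [Set.indicator_of_mem h, Set.indicator_of_mem (by exact h)]
    · rw [Set.indicator_of_notMem h, Set.indicator_of_notMem (by exact h)]
  rw [this]
  refine Measurable.indicator ?_ (hr hs)
  unfold lossKernel
  fun_prop

/-- Isolates `t (b² - r)`, the quantity that stays of order one after rescaling. -/
theorem exp_neg_mul_lossKernel {t r : ℝ} (ht : t ≠ 0) (hr : r ≠ 0) (b s : ℝ) :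
    Real.exp (-(b * t)) * lossKernel (b ^ 2) r (t * (b - s / t)) =
      ((b ^ 2 - r) ^ 2 / r + 2 * (t * (b ^ 2 - r)) / r * (b - s / t)) *
        Real.exp (-r / 2 - s) := by
  unfold lossKernel
  rw [mul_left_comm, ← Real.exp_add]
  congr 1
  · field_simp
    ring
  · congr 1
    field_simp
    ring

/-! ### Laplace's method at the boundary point. -/

section Laplace

variable {V : Type*} [NormedAddCommGroup V] [InnerProductSpace ℝ V]
  [FiniteDimensional ℝ V] [MeasurableSpace V] [BorelSpace V]

/-- The exponential varies on scale `1/t` along the axis; as the sphere curves quadratically, the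
transverse scale is `1/√t`. -/
theorem integral_rescale (b t : ℝ) (ht : 0 < t) (f : ℝ × V → ℝ) :
    ∫ x, f x = t⁻¹ * ((√t) ^ Module.finrank ℝ V)⁻¹ *
      ∫ x : ℝ × V, f (b - x.1 / t, (√t)⁻¹ • x.2) := by
  have hs : 0 < √t := Real.sqrt_pos.2 ht
  let e1 : ℝ ≃ᵐ ℝ := (MeasurableEquiv.smul₀ t⁻¹ (inv_ne_zero ht.ne')).trans
    (MeasurableEquiv.subLeft b)
  let e2 : V ≃ᵐ V := MeasurableEquiv.smul₀ (√t)⁻¹ (inv_ne_zero hs.ne')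
  have h1 : Measure.map e1 (volume : Measure ℝ) = ENNReal.ofReal t • volume := by
    have : (e1 : ℝ → ℝ) = (fun x => b - x) ∘ (fun x => t⁻¹ • x) := rfl
    rw [this, ← Measure.map_map (by fun_prop) (by fun_prop),
      Measure.map_addHaar_smul _ (inv_ne_zero ht.ne'), Measure.map_smul,
      (Measure.measurePreserving_sub_left volume b).map_eq]
    simp [abs_of_pos ht]
  have h2 : Measure.map e2 (volume : Measure V) =
      ENNReal.ofReal ((√t) ^ Module.finrank ℝ V) • volume := by
    have : (e2 : V → V) = (fun x => (√t)⁻¹ • x) := rfl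
    rw [this, Measure.map_addHaar_smul _ (inv_ne_zero hs.ne')]
    simp [abs_of_pos hs]
  have h3 : Measure.map (e1.prodCongr e2) (volume : Measure (ℝ × V)) =
      (ENNReal.ofReal t * ENNReal.ofReal ((√t) ^ Module.finrank ℝ V)) • volume := by
    have : (e1.prodCongr e2 : ℝ × V → ℝ × V) = Prod.map e1 e2 := rfl
    rw [this, Measure.volume_eq_prod, ← Measure.map_prod_map _ _ e1.measurable e2.measurable,
      h1, h2, Measure.prod_smul_left, Measure.prod_smul_right, smul_smul]
  have h4 : ∫ x : ℝ × V, f (b - x.1 / t, (√t)⁻¹ • x.2) =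
      ∫ x, f x ∂(Measure.map (e1.prodCongr e2) (volume : Measure (ℝ × V))) := by
    rw [integral_map_equiv]
    refine integral_congr_ae (Eventually.of_forall fun x => ?_)
    have : e1.prodCongr e2 x = (b - t⁻¹ * x.1, (√t)⁻¹ • x.2) := rfl
    simp only [this]
    congr 3
    rw [div_eq_inv_mul]
  rw [h4, h3, integral_smul_measure, ENNReal.toReal_mul, ENNReal.toReal_ofReal ht.le,
    ENNReal.toReal_ofReal (by positivity), smul_eq_mul]
  field_simp

/-- Inside the ball `t (b² - r) = 2bs - q - s²/t` is positive, so `s > 0` and `q ≤ 2bs`. Half of the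
decay `exp(-s)` can then be traded for `exp(-q/(4b))`. The constant 16 comes from `r ≥ b²/4`. -/
theorem abs_rescaled_lossKernel_le {b t : ℝ} (hb : 0 < b) (ht : 1 ≤ t) (s q : ℝ) (hq : 0 ≤ q) :
    |Real.exp (-(b * t)) * (Set.Ico (b ^ 2 / 4) (b ^ 2)).indicator
      (fun r => lossKernel (b ^ 2) r (t * (b - s / t))) ((b - s / t) ^ 2 + q / t)| ≤
    (Set.Ioi 0).indicator (fun s => 16 * (s ^ 2 + s) * Real.exp (-(1 / 2) * s)) s *
      Real.exp (-(1 / (4 * b)) * q) := by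
  have ht0 : 0 < t := by linarith
  set r := (b - s / t) ^ 2 + q / t with hr
  by_cases hmem : r ∈ Set.Ico (b ^ 2 / 4) (b ^ 2)
  swap
  · rw [Set.indicator_of_notMem hmem, mul_zero, abs_zero]
    refine mul_nonneg (Set.indicator_nonneg (fun s hs => ?_) _) (Real.exp_nonneg _)
    have : 0 < s := hs
    positivity
  have hD : t * (b ^ 2 - r) = 2 * b * s - q - s ^ 2 / t := by
    rw [hr]
    field_simp
    ring
  have hDpos : 0 < t * (b ^ 2 - r) := mul_pos ht0 (by linarith [hmem.2])
  have hst : 0 ≤ s ^ 2 / t := by positivity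
  have hqs : q ≤ 2 * b * s := by linarith
  have hs : 0 < s := by
    have : 0 < 2 * b * s := by linarith
    exact pos_of_mul_pos_right this (by positivity)
  have hb2 : 0 < b ^ 2 := by positivity
  have hr0 : 0 < r := lt_of_lt_of_le (by positivity) hmem.1
  have hu : |b - s / t| ≤ b := by
    have h0 : 0 ≤ q / t := by positivity
    exact abs_le_of_sq_le_sq (by linarith [hmem.2]) hb.le
  rw [Set.indicator_of_mem hmem, Set.indicator_of_mem (show s ∈ Set.Ioi 0 from hs)]
  rw [exp_neg_mul_lossKernel ht0.ne' hr0.ne', abs_mul, abs_of_pos (Real.exp_pos _)]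
  have e1 : (b ^ 2 - r) ^ 2 / r ≤ 16 * s ^ 2 := by
    have h1 : b ^ 2 - r ≤ 2 * b * s := by
      have : b ^ 2 - r ≤ t * (b ^ 2 - r) := le_mul_of_one_le_left (by linarith [hmem.2]) ht
      linarith
    have h2 : (b ^ 2 - r) ^ 2 ≤ (2 * b * s) ^ 2 :=
      pow_le_pow_left₀ (by linarith [hmem.2]) h1 2
    rw [div_le_iff₀ hr0]
    nlinarith [hmem.1, sq_nonneg s]
  have e2 : 2 * (t * (b ^ 2 - r)) / r * |b - s / t| ≤ 16 * s := by
    have h1 : t * (b ^ 2 - r) ≤ 2 * b * s := by linarith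
    calc 2 * (t * (b ^ 2 - r)) / r * |b - s / t| ≤ 2 * (2 * b * s) / (b ^ 2 / 4) * b := by
          gcongr
          exact hmem.1
      _ = 16 * s := by
          field_simp
          ring
  have e3 : Real.exp (-r / 2 - s) ≤ Real.exp (-(1 / 2) * s) * Real.exp (-(1 / (4 * b)) * q) := by
    rw [← Real.exp_add]
    apply Real.exp_le_exp.2
    have : 1 / (4 * b) * q ≤ s / 2 := by
      rw [one_div, inv_mul_le_iff₀ (by positivity)]
      linarith
    linarith
  calc _ ≤ ((b ^ 2 - r) ^ 2 / r + 2 * (t * (b ^ 2 - r)) / r * |b - s / t|) *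
        Real.exp (-r / 2 - s) := by
        gcongr
        refine (abs_add_le _ _).trans ?_
        rw [abs_mul, abs_of_nonneg (by positivity : (0:ℝ) ≤ (b ^ 2 - r) ^ 2 / r),
          abs_of_nonneg (by positivity : (0:ℝ) ≤ 2 * (t * (b ^ 2 - r)) / r)]
    _ ≤ (16 * (s ^ 2 + s)) * (Real.exp (-(1 / 2) * s) * Real.exp (-(1 / (4 * b)) * q)) := by
        gcongr
        linarith
    _ = _ := by ring

theorem tendsto_rescaled_lossKernel {b : ℝ} (hb : 0 < b) (s q : ℝ) :
    Tendsto (fun t => Real.exp (-(b * t)) * (Set.Ico (b ^ 2 / 4) (b ^ 2)).indicator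
      (fun r => lossKernel (b ^ 2) r (t * (b - s / t))) ((b - s / t) ^ 2 + q / t)) atTop
      (𝓝 (2 / b * max (2 * b * s - q) 0 * Real.exp (-b ^ 2 / 2 - s))) := by
  have hD : ∀ t : ℝ, 0 < t →
      t * (b ^ 2 - ((b - s / t) ^ 2 + q / t)) = 2 * b * s - q - s ^ 2 / t := by
    intro t ht
    field_simp
    ring
  -- If `2bs ≤ q` the rescaled point lies outside the ball for every `t > 0`; otherwise it is
  -- eventually in the shell.
  rcases le_or_gt (2 * b * s - q) 0 with h | h
  · rw [max_eq_right h, mul_zero, zero_mul]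
    refine tendsto_const_nhds.congr' ?_
    filter_upwards [eventually_gt_atTop 0] with t ht
    rw [Set.indicator_of_notMem, mul_zero]
    rintro ⟨-, h2⟩
    have h3 : 0 < t * (b ^ 2 - ((b - s / t) ^ 2 + q / t)) := mul_pos ht (by linarith)
    rw [hD t ht] at h3
    have : 0 ≤ s ^ 2 / t := by positivity
    linarith
  have hb2 : 0 < b ^ 2 := by positivity
  have hst : ∀ c : ℝ, Tendsto (fun t : ℝ => c / t) atTop (𝓝 0) := fun c =>
    tendsto_const_nhds.div_atTop tendsto_id
  have hu : Tendsto (fun t => b - s / t) atTop (𝓝 b) := by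
    simpa using tendsto_const_nhds.sub (hst s)
  have hr : Tendsto (fun t => (b - s / t) ^ 2 + q / t) atTop (𝓝 (b ^ 2)) := by
    simpa using (hu.pow 2).add (hst q)
  have hD' : Tendsto (fun t => 2 * b * s - q - s ^ 2 / t) atTop (𝓝 (2 * b * s - q)) := by
    simpa using tendsto_const_nhds.sub (hst (s ^ 2))
  have hlim : Tendsto (fun t => ((b ^ 2 - ((b - s / t) ^ 2 + q / t)) ^ 2 /
      ((b - s / t) ^ 2 + q / t) + 2 * (2 * b * s - q - s ^ 2 / t) /
      ((b - s / t) ^ 2 + q / t) * (b - s / t)) *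
        Real.exp (-((b - s / t) ^ 2 + q / t) / 2 - s)) atTop
      (𝓝 (((b ^ 2 - b ^ 2) ^ 2 / b ^ 2 + 2 * (2 * b * s - q) / b ^ 2 * b) *
        Real.exp (-b ^ 2 / 2 - s))) :=
    ((((tendsto_const_nhds.sub hr).pow 2).div hr hb2.ne').add
      (((hD'.const_mul 2).div hr hb2.ne').mul hu)).mul
      (Real.continuous_exp.continuousAt.tendsto.comp ((hr.neg.div_const 2).sub_const s))
  rw [show 2 / b * max (2 * b * s - q) 0 * Real.exp (-b ^ 2 / 2 - s) =
      ((b ^ 2 - b ^ 2) ^ 2 / b ^ 2 + 2 * (2 * b * s - q) / b ^ 2 * b) *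
        Real.exp (-b ^ 2 / 2 - s) by
    rw [max_eq_left h.le]
    congr 1
    field_simp
    ring]
  refine hlim.congr' ?_
  filter_upwards [eventually_gt_atTop 0, hr.eventually_const_lt (by linarith : b ^ 2 / 4 < b ^ 2),
    hD'.eventually_const_lt h] with t ht h1 h2
  rw [← hD t ht] at h2 ⊢
  set r := (b - s / t) ^ 2 + q / t with hrdef
  have hr0 : 0 < r := by linarith
  rw [Set.indicator_of_mem
    (show r ∈ Set.Ico (b ^ 2 / 4) (b ^ 2) from ⟨h1.le, by linarith [pos_of_mul_pos_right h2 ht.le]⟩)]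
  rw [exp_neg_mul_lossKernel ht.ne' hr0.ne']

theorem integrable_rescaled_bound {b : ℝ} (hb : 0 < b) : Integrable fun x : ℝ × V =>
    (Set.Ioi 0).indicator (fun s => 16 * (s ^ 2 + s) * Real.exp (-(1 / 2) * s)) x.1 *
      Real.exp (-(1 / (4 * b)) * ‖x.2‖ ^ 2) := by
  refine Integrable.mul_prod (f := (Set.Ioi 0).indicator
    (fun s : ℝ => 16 * (s ^ 2 + s) * Real.exp (-(1 / 2) * s)))
    (g := fun z : V => Real.exp (-(1 / (4 * b)) * ‖z‖ ^ 2)) ?_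
    (integrable_gaussian_sq_norm (by positivity))
  rw [integrable_indicator_iff measurableSet_Ioi]
  have h1 := integrableOn_rpow_mul_exp_neg_mul_rpow (s := 2) (p := 1) (b := 1 / 2)
    (by norm_num) (by norm_num) (by norm_num)
  have h2 := integrableOn_rpow_mul_exp_neg_mul_rpow (s := 1) (p := 1) (b := 1 / 2)
    (by norm_num) (by norm_num) (by norm_num)
  refine ((h1.add h2).const_mul 16).congr (Eventually.of_forall fun x => ?_)
  simp
  ring

theorem tendsto_integral_rescaled_lossKernel {b : ℝ} (hb : 0 < b) :
    Tendsto (fun t => ∫ x : ℝ × V, Real.exp (-(b * t)) *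
      (Set.Ico (b ^ 2 / 4) (b ^ 2)).indicator
        (fun r => lossKernel (b ^ 2) r (t * (b - x.1 / t)))
          ((b - x.1 / t) ^ 2 + ‖x.2‖ ^ 2 / t)) atTop
      (𝓝 (∫ x : ℝ × V, 2 / b * max (2 * b * x.1 - ‖x.2‖ ^ 2) 0 *
        Real.exp (-b ^ 2 / 2 - x.1))) := by
  refine tendsto_integral_filter_of_dominated_convergence _ (Eventually.of_forall fun t => ?_) ?_
    (integrable_rescaled_bound (V := V) hb)
    (Eventually.of_forall fun x => tendsto_rescaled_lossKernel hb x.1 (‖x.2‖ ^ 2))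
  · exact ((measurable_indicator_lossKernel measurableSet_Ico _ (by fun_prop)
      (by fun_prop)).const_mul _).aestronglyMeasurable
  · filter_upwards [eventually_ge_atTop 1] with t ht
    exact Eventually.of_forall fun x => abs_rescaled_lossKernel_le hb ht x.1 _ (by positivity)

theorem integral_max_sub_mul_exp {b : ℝ} (hb : 0 < b) (q : ℝ) :
    ∫ s, 2 / b * max (2 * b * s - q) 0 * Real.exp (-b ^ 2 / 2 - s) =
      4 * Real.exp (-b ^ 2 / 2) * Real.exp (-(1 / (2 * b)) * q) := by
  -- Shifting `s` to the edge of the support leaves a multiple of `∫ s exp(-s) = Γ(2) = 1`.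
  rw [← integral_add_right_eq_self _ (q / (2 * b))]
  have h : ∀ s : ℝ, 2 / b * max (2 * b * (s + q / (2 * b)) - q) 0 *
      Real.exp (-b ^ 2 / 2 - (s + q / (2 * b))) =
      4 * Real.exp (-b ^ 2 / 2) * Real.exp (-(1 / (2 * b)) * q) *
        (Set.Ioi 0).indicator (fun s => s ^ ((2 : ℝ) - 1) * Real.exp (-(1 * s))) s := by
    intro s
    have e : 2 * b * (s + q / (2 * b)) - q = 2 * b * s := by
      field_simp
      ring
    have e2 : Real.exp (-b ^ 2 / 2 - (s + q / (2 * b))) =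
        Real.exp (-b ^ 2 / 2) * Real.exp (-(1 / (2 * b)) * q) * Real.exp (-(1 * s)) := by
      rw [← Real.exp_add, ← Real.exp_add]
      congr 1
      ring
    rw [e, e2]
    by_cases hs : 0 < s
    · rw [Set.indicator_of_mem (show s ∈ Set.Ioi 0 from hs), max_eq_left (by positivity)]
      norm_num
      field_simp
      ring
    · rw [Set.indicator_of_notMem (show s ∉ Set.Ioi 0 from hs), max_eq_right]
      · ring
      · nlinarith
  simp_rw [h]
  rw [integral_const_mul, integral_indicator measurableSet_Ioi,
    Real.integral_rpow_mul_exp_neg_mul_Ioi (by norm_num) (by norm_num)]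
  simp

theorem integral_laplace_limit {b : ℝ} (hb : 0 < b) :
    ∫ x : ℝ × V, 2 / b * max (2 * b * x.1 - ‖x.2‖ ^ 2) 0 * Real.exp (-b ^ 2 / 2 - x.1) =
      4 * Real.exp (-b ^ 2 / 2) * (2 * Real.pi * b) ^ ((Module.finrank ℝ V : ℝ) / 2) := by
  have hint : Integrable fun x : ℝ × V =>
      2 / b * max (2 * b * x.1 - ‖x.2‖ ^ 2) 0 * Real.exp (-b ^ 2 / 2 - x.1) := by
    refine (integrable_rescaled_bound (V := V) hb).mono' (by fun_prop)
      (Eventually.of_forall fun x => ?_)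
    -- The limit inherits the dominating function of the rescaled kernels.
    refine le_of_tendsto (tendsto_rescaled_lossKernel hb x.1 (‖x.2‖ ^ 2)).norm ?_
    filter_upwards [eventually_ge_atTop 1] with t ht
    exact abs_rescaled_lossKernel_le hb ht x.1 _ (by positivity)
  rw [Measure.volume_eq_prod, integral_prod_symm _ hint]
  simp only
  simp_rw [integral_max_sub_mul_exp hb]
  rw [integral_const_mul, GaussianFourier.integral_rexp_neg_mul_sq_norm (by positivity)]
  congr 2
  field_simp

end Laplace

/-! ### Rotation of `θ` onto an axis. -/

section Rotation

variable {V E : Type*} [NormedAddCommGroup V] [InnerProductSpace ℝ V]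
  [FiniteDimensional ℝ V] [NormedAddCommGroup E] [InnerProductSpace ℝ E]
  [FiniteDimensional ℝ E]

/-- Any isometry sends the axis vector to some vector of norm `‖θ‖`; reflecting in the hyperplane
orthogonal to its difference from `θ` carries it to `θ`. -/
theorem exists_linearIsometryEquiv_prod_apply_eq
    (h : Module.finrank ℝ E = Module.finrank ℝ V + 1) (θ : E) :
    ∃ φ : WithLp 2 (ℝ × V) ≃ₗᵢ[ℝ] E, φ (WithLp.toLp 2 (‖θ‖, 0)) = θ := by
  have hd : Module.finrank ℝ (WithLp 2 (ℝ × V)) = Module.finrank ℝ E := by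
    rw [h, (WithLp.linearEquiv 2 ℝ (ℝ × V)).finrank_eq, Module.finrank_prod,
      Module.finrank_self, add_comm]
  let φ₀ : WithLp 2 (ℝ × V) ≃ₗᵢ[ℝ] E :=
    ((stdOrthonormalBasis ℝ (WithLp 2 (ℝ × V))).reindex (finCongr hd)).repr.trans
      (stdOrthonormalBasis ℝ E).repr.symm
  have hn : ‖φ₀ (WithLp.toLp 2 (‖θ‖, 0))‖ = ‖θ‖ := by
    rw [φ₀.norm_map, ← sq_eq_sq₀ (norm_nonneg _) (norm_nonneg _), WithLp.prod_norm_sq_eq_of_L2]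
    simp
  exact ⟨φ₀.trans (ℝ ∙ (φ₀ (WithLp.toLp 2 (‖θ‖, 0)) - θ))ᗮ.reflection,
    Submodule.reflection_sub hn⟩

variable [MeasurableSpace V] [BorelSpace V] [MeasurableSpace E] [BorelSpace E]

theorem integral_norm_sq_inner_eq_integral_prod
    (h : Module.finrank ℝ E = Module.finrank ℝ V + 1) (θ : E) (F : ℝ → ℝ → ℝ) :
    ∫ x : E, F (‖x‖ ^ 2) (inner ℝ x θ) =
      ∫ y : ℝ × V, F (y.1 ^ 2 + ‖y.2‖ ^ 2) (‖θ‖ * y.1) := by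
  obtain ⟨φ, hφ⟩ := exists_linearIsometryEquiv_prod_apply_eq (V := V) h θ
  rw [← φ.measurePreserving.integral_comp φ.toHomeomorph.measurableEmbedding,
    ← (WithLp.volume_preserving_toLp ℝ V).integral_comp
      (MeasurableEquiv.toLp 2 (ℝ × V)).measurableEmbedding]
  refine integral_congr_ae (Eventually.of_forall fun y => ?_)
  have h1 : inner ℝ (φ (WithLp.toLp 2 y)) θ = ‖θ‖ * y.1 := by
    conv_lhs => rw [← hφ]
    rw [φ.inner_map_map, WithLp.prod_inner_apply]
    simp [mul_comm]
  simp only [h1, φ.norm_map, WithLp.prod_norm_sq_eq_of_L2]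
  simp

theorem tendsto_outer_integral {b : ℝ} (hb : 0 < b) :
    Tendsto (fun t : ℝ => t ^ (((Module.finrank ℝ V : ℝ) + 2) / 2) * Real.exp (-(b * t)) *
      ∫ y : ℝ × V, (Set.Ico (b ^ 2 / 4) (b ^ 2)).indicator
        (fun r => lossKernel (b ^ 2) r (t * y.1)) (y.1 ^ 2 + ‖y.2‖ ^ 2)) atTop
      (𝓝 (4 * Real.exp (-b ^ 2 / 2) * (2 * Real.pi * b) ^ ((Module.finrank ℝ V : ℝ) / 2))) := by
  rw [← integral_laplace_limit hb]
  refine (tendsto_integral_rescaled_lossKernel (V := V) hb).congr' ?_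
  filter_upwards [eventually_gt_atTop 0] with t ht
  rw [integral_const_mul]
  conv_rhs => rw [integral_rescale b t ht]
  have h1 : ∀ z : V, ‖(√t)⁻¹ • z‖ ^ 2 = ‖z‖ ^ 2 / t := by
    intro z
    rw [norm_smul, mul_pow, norm_inv, inv_pow, Real.norm_eq_abs, sq_abs, Real.sq_sqrt ht.le,
      inv_mul_eq_div]
  simp_rw [h1]
  have h2 : t ^ (((Module.finrank ℝ V : ℝ) + 2) / 2) * (t⁻¹ * (√t ^ Module.finrank ℝ V)⁻¹) = 1 := by
    rw [← Real.rpow_natCast (√t), Real.sqrt_eq_rpow, ← Real.rpow_mul ht.le,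
      add_div, Real.rpow_add ht]
    have : 0 < t ^ ((Module.finrank ℝ V : ℝ) / 2) := Real.rpow_pos_of_pos ht _
    rw [show (1 / 2 : ℝ) * (Module.finrank ℝ V : ℝ) = (Module.finrank ℝ V : ℝ) / 2 by ring]
    norm_num
    field_simp
  generalize (∫ a : ℝ × V, (Set.Ico (b ^ 2 / 4) (b ^ 2)).indicator
    (fun r => lossKernel (b ^ 2) r (t * (b - a.1 / t)))
      ((b - a.1 / t) ^ 2 + ‖a.2‖ ^ 2 / t)) = I
  linear_combination (-Real.exp (-(b * t)) * I) * h2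

end Rotation

/-! ### The inner ball `‖x‖ < b/2`. -/

/-- Here `⟪x, θ⟫ ≤ b‖θ‖/2`, half the exponential rate at the boundary, and the algebraic factor is
`O(1/‖x‖²)`. -/
theorem abs_inner_lossKernel_le {E : Type*} [NormedAddCommGroup E] [InnerProductSpace ℝ E]
    {b : ℝ} (hb : 0 < b) (θ x : E) :
    ‖(Set.Iio (b ^ 2 / 4)).indicator (fun r => lossKernel (b ^ 2) r (inner ℝ x θ)) (‖x‖ ^ 2)‖ ≤
      (b ^ 4 + 2 * b ^ 3 * ‖θ‖) * Real.exp (b * ‖θ‖ / 2) *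
        (Metric.ball 0 b).indicator (fun x : E => (‖x‖ ^ 2)⁻¹) x := by
  have hbound : 0 ≤ (b ^ 4 + 2 * b ^ 3 * ‖θ‖) * Real.exp (b * ‖θ‖ / 2) *
      (Metric.ball 0 b).indicator (fun x : E => (‖x‖ ^ 2)⁻¹) x :=
    mul_nonneg (by positivity) (Set.indicator_nonneg (fun _ _ => by positivity) _)
  by_cases hx : ‖x‖ ^ 2 ∈ Set.Iio (b ^ 2 / 4)
  swap
  · rwa [Set.indicator_of_notMem hx, norm_zero]
  rw [Set.indicator_of_mem hx]
  rcases eq_or_ne x 0 with rfl | hx0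
  · have h0 : lossKernel (b ^ 2) (‖(0 : E)‖ ^ 2) (inner ℝ 0 θ) = 0 := by simp [lossKernel]
    rwa [h0, norm_zero]
  have hn : 0 < ‖x‖ := norm_pos_iff.2 hx0
  have hnb : ‖x‖ < b / 2 := by
    refine lt_of_pow_lt_pow_left₀ 2 (by positivity) ?_
    have : ‖x‖ ^ 2 < b ^ 2 / 4 := hx
    linarith
  rw [Set.indicator_of_mem (show x ∈ Metric.ball (0 : E) b by simp; linarith)]
  have hm := abs_real_inner_le_norm x θ
  set m := inner ℝ x θ
  set ρ := ‖x‖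
  set t := ‖θ‖
  have ht : 0 ≤ t := norm_nonneg θ
  have hg1 : |1 - b ^ 2 / ρ ^ 2| ≤ b ^ 2 / ρ ^ 2 := by
    have : 1 ≤ b ^ 2 / ρ ^ 2 := by
      rw [one_le_div (by positivity)]
      gcongr
      linarith
    rw [abs_of_nonpos (by linarith)]
    linarith
  have e1 : (1 - b ^ 2 / ρ ^ 2) ^ 2 * ρ ^ 2 ≤ b ^ 4 * (ρ ^ 2)⁻¹ := by
    calc _ ≤ (b ^ 2 / ρ ^ 2) ^ 2 * ρ ^ 2 := by
          rw [← sq_abs]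
          gcongr
      _ = _ := by field_simp
  have e2 : 2 * |1 - b ^ 2 / ρ ^ 2| * |m| ≤ 2 * b ^ 3 * t * (ρ ^ 2)⁻¹ := by
    calc _ ≤ 2 * (b ^ 2 / ρ ^ 2) * (b * t) := by
          gcongr
          refine hm.trans ?_
          gcongr
          linarith
      _ = _ := by field_simp
  have e3 : Real.exp (-ρ ^ 2 / 2 + m) ≤ Real.exp (b * t / 2) := by
    apply Real.exp_le_exp.2
    have h1 : m ≤ b / 2 * t := (le_abs_self m).trans (hm.trans (by gcongr))
    have h2 : 0 ≤ ρ ^ 2 := by positivity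
    linarith
  unfold lossKernel
  rw [norm_mul, Real.norm_eq_abs, Real.norm_eq_abs, Real.abs_exp]
  calc _ ≤ (b ^ 4 * (ρ ^ 2)⁻¹ + 2 * b ^ 3 * t * (ρ ^ 2)⁻¹) * Real.exp (b * t / 2) := by
        gcongr
        refine (abs_sub _ _).trans ?_
        rw [abs_mul, abs_mul, abs_mul, abs_two, abs_of_nonneg (sq_nonneg (1 - b ^ 2 / ρ ^ 2)),
          abs_of_nonneg (sq_nonneg ρ)]
        exact add_le_add e1 e2
    _ = _ := by ring


/-! ### The risk difference and its limit. -/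

section Risk

variable {p : ℕ}

theorem integrable_inner_lossKernel (hp : 3 ≤ p) {b : ℝ} (hb : 0 < b)
    (θ : EuclideanSpace ℝ (Fin p)) :
    Integrable fun x : EuclideanSpace ℝ (Fin p) =>
      (Set.Iio (b ^ 2 / 4)).indicator (fun r => lossKernel (b ^ 2) r (inner ℝ x θ)) (‖x‖ ^ 2) :=
  (((integrable_indicator_iff measurableSet_ball).2
    (integrableOn_ball_inv_sq_norm hp b)).const_mul _).mono'
    (measurable_indicator_lossKernel measurableSet_Iio _ (by fun_prop)
      (by fun_prop)).aestronglyMeasurable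
    (Eventually.of_forall (abs_inner_lossKernel_le hb θ))

/-- The remaining factor `exp(-b‖θ‖/2)` beats every power of `‖θ‖`. -/
theorem tendsto_inner_integral (hp : 3 ≤ p) {b : ℝ} (hb : 0 < b) (k : ℝ) :
    Tendsto (fun θ : EuclideanSpace ℝ (Fin p) => ‖θ‖ ^ k * Real.exp (-(b * ‖θ‖)) *
      ∫ x, (Set.Iio (b ^ 2 / 4)).indicator
        (fun r => lossKernel (b ^ 2) r (inner ℝ x θ)) (‖x‖ ^ 2))
      (comap (fun θ => ‖θ‖) atTop) (𝓝 0) := by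
  set C := ∫ x : EuclideanSpace ℝ (Fin p), (Metric.ball 0 b).indicator (fun x => (‖x‖ ^ 2)⁻¹) x
    with hC
  have hlim : Tendsto (fun t : ℝ => C * b ^ 4 * (t ^ k * Real.exp (-(b / 2) * t)) +
      2 * C * b ^ 3 * (t ^ (k + 1) * Real.exp (-(b / 2) * t))) atTop (𝓝 0) := by
    have h := fun s : ℝ => tendsto_rpow_mul_exp_neg_mul_atTop_nhds_zero s (b / 2) (by positivity)
    simpa using ((h k).const_mul (C * b ^ 4)).add ((h (k + 1)).const_mul (2 * C * b ^ 3))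
  refine squeeze_zero_norm' ?_ (hlim.comp tendsto_comap)
  have hpos : ∀ᶠ θ : EuclideanSpace ℝ (Fin p) in comap (fun θ => ‖θ‖) atTop, 0 < ‖θ‖ :=
    tendsto_comap.eventually (eventually_gt_atTop 0)
  filter_upwards [hpos] with θ hθ
  have h1 := norm_integral_le_of_norm_le (((integrable_indicator_iff measurableSet_ball).2
    (integrableOn_ball_inv_sq_norm hp b)).const_mul _)
    (Eventually.of_forall (abs_inner_lossKernel_le hb θ))
  rw [integral_const_mul, ← hC] at h1
  simp only [Function.comp_apply]
  rw [norm_mul, Real.norm_of_nonneg (by positivity)]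
  refine (mul_le_mul_of_nonneg_left h1 (by positivity)).trans (le_of_eq ?_)
  have h2 : Real.exp (-(b * ‖θ‖)) * Real.exp (b * ‖θ‖ / 2) = Real.exp (-(b / 2) * ‖θ‖) := by
    rw [← Real.exp_add]
    congr 1
    ring
  rw [← h2, Real.rpow_add_one hθ.ne']
  ring

theorem quadLoss_jamesStein_sub (hp : 3 ≤ p) (θ x : EuclideanSpace ℝ (Fin p)) :
    gaussianDensity θ x * (quadLoss θ (jamesStein p x) - quadLoss θ (jamesSteinPos p x)) =
      (2 * Real.pi) ^ (-(p : ℝ) / 2) * Real.exp (-‖θ‖ ^ 2 / 2) *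
        (Set.Iio ((p : ℝ) - 2)).indicator
          (fun r => lossKernel ((p : ℝ) - 2) r (inner ℝ x θ)) (‖x‖ ^ 2) := by
  have hpp : (0 : ℝ) < (p : ℝ) - 2 := by
    have : (3 : ℝ) ≤ p := by exact_mod_cast hp
    linarith
  unfold jamesStein jamesSteinPos quadLoss
  rcases eq_or_ne x 0 with rfl | hx0
  · simp [lossKernel, hpp]
  have hn : 0 < ‖x‖ := norm_pos_iff.2 hx0
  by_cases hx : ‖x‖ ^ 2 ∈ Set.Iio ((p : ℝ) - 2)
  · rw [Set.indicator_of_mem hx]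
    have hlt : ‖x‖ ^ 2 < (p : ℝ) - 2 := hx
    have hg : 1 - ((p : ℝ) - 2) / ‖x‖ ^ 2 ≤ 0 := by
      rw [sub_nonpos, one_le_div (by positivity)]
      exact hlt.le
    have he : Real.exp (-‖x - θ‖ ^ 2 / 2) =
        Real.exp (-‖θ‖ ^ 2 / 2) * Real.exp (-‖x‖ ^ 2 / 2 + inner ℝ x θ) := by
      rw [← Real.exp_add, norm_sub_sq_real]
      congr 1
      ring
    rw [max_eq_left hg, zero_smul, zero_sub, norm_neg, norm_sub_sq_real, norm_smul, mul_pow,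
      Real.norm_eq_abs, sq_abs, real_inner_smul_left, gaussianDensity, he, lossKernel]
    ring
  · rw [Set.indicator_of_notMem hx, max_eq_right]
    · simp
    · rw [sub_nonneg, div_le_one (by positivity)]
      simpa using hx

theorem quadRisk_jamesStein_sub (hp : 3 ≤ p) {b : ℝ} (hb : 0 < b) (hbp : b ^ 2 = (p : ℝ) - 2)
    (θ : EuclideanSpace ℝ (Fin p)) :
    quadRisk θ (jamesStein p) - quadRisk θ (jamesSteinPos p) =
      (2 * Real.pi) ^ (-(p : ℝ) / 2) * Real.exp (-‖θ‖ ^ 2 / 2) *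
        ((∫ x : EuclideanSpace ℝ (Fin p), (Set.Ico (b ^ 2 / 4) (b ^ 2)).indicator
            (fun r => lossKernel (b ^ 2) r (inner ℝ x θ)) (‖x‖ ^ 2)) +
          ∫ x : EuclideanSpace ℝ (Fin p), (Set.Iio (b ^ 2 / 4)).indicator
            (fun r => lossKernel (b ^ 2) r (inner ℝ x θ)) (‖x‖ ^ 2)) := by
  have hi := (integrable_quadLoss_jamesStein hp θ).sub (integrable_quadLoss_jamesSteinPos hp θ)
  have hi' := (integrable_multivariateGaussian_one_iff θ _).1 hi
  simp only [Pi.sub_apply, quadLoss_jamesStein_sub hp, ← hbp] at hi'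
  have hc : (2 * Real.pi) ^ (-(p : ℝ) / 2) * Real.exp (-‖θ‖ ^ 2 / 2) ≠ 0 := by positivity
  rw [integrable_const_mul_iff (IsUnit.mk0 _ hc)] at hi'
  unfold quadRisk
  rw [← integral_sub (integrable_quadLoss_jamesStein hp θ) (integrable_quadLoss_jamesSteinPos hp θ),
    integral_multivariateGaussian_one]
  simp_rw [quadLoss_jamesStein_sub hp, ← hbp]
  rw [integral_const_mul]
  congr 1
  -- The shell integral is whole minus inner; integrability over the whole ball follows from the
  -- finite risks.
  rw [← sub_eq_iff_eq_add, ← integral_sub hi' (integrable_inner_lossKernel hp hb θ)]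
  refine integral_congr_ae (Eventually.of_forall fun x => ?_)
  have hb2 : 0 < b ^ 2 := by positivity
  simp only [Set.indicator_apply, Set.mem_Iio, Set.mem_Ico]
  split_ifs <;> first | ring1 | (exfalso; grind)

theorem tendsto_risk_difference (hp : 3 ≤ p) {b : ℝ} (hb : 0 < b) (hbp : b ^ 2 = (p : ℝ) - 2) :
    Tendsto (fun θ : EuclideanSpace ℝ (Fin p) =>
      ‖θ‖ ^ (((p : ℝ) + 1) / 2) * Real.exp (-(b * ‖θ‖)) * Real.exp (‖θ‖ ^ 2 / 2) *
        (quadRisk θ (jamesStein p) - quadRisk θ (jamesSteinPos p)))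
      (comap (fun θ => ‖θ‖) atTop)
      (𝓝 ((2 * Real.pi) ^ (-(p : ℝ) / 2) *
        (4 * Real.exp (-b ^ 2 / 2) * (2 * Real.pi * b) ^ (((p : ℝ) - 1) / 2)))) := by
  have hfin : (Module.finrank ℝ (EuclideanSpace ℝ (Fin (p - 1))) : ℝ) = (p : ℝ) - 1 := by
    rw [finrank_euclideanSpace_fin, Nat.cast_sub (by omega), Nat.cast_one]
  have hout := (tendsto_outer_integral (V := EuclideanSpace ℝ (Fin (p - 1))) hb).comp
    (tendsto_comap (f := fun θ : EuclideanSpace ℝ (Fin p) => ‖θ‖) (x := atTop))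
  rw [hfin, show ((p : ℝ) - 1 + 2) / 2 = ((p : ℝ) + 1) / 2 by ring] at hout
  have h := (hout.add (tendsto_inner_integral hp hb (((p : ℝ) + 1) / 2))).const_mul
    ((2 * Real.pi) ^ (-(p : ℝ) / 2))
  rw [add_zero] at h
  refine h.congr fun θ => ?_
  have hrot := integral_norm_sq_inner_eq_integral_prod (V := EuclideanSpace ℝ (Fin (p - 1)))
    (by simp; omega) θ
    (fun r m => (Set.Ico (b ^ 2 / 4) (b ^ 2)).indicator (fun r => lossKernel (b ^ 2) r m) r)
  have he : Real.exp (‖θ‖ ^ 2 / 2) * Real.exp (-‖θ‖ ^ 2 / 2) = 1 := by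
    rw [← Real.exp_add, neg_div, add_neg_cancel, Real.exp_zero]
  rw [quadRisk_jamesStein_sub hp hb hbp, hrot]
  simp only [Function.comp_apply]
  generalize (∫ x : EuclideanSpace ℝ (Fin p), (Set.Iio (b ^ 2 / 4)).indicator
    (fun r => lossKernel (b ^ 2) r (inner ℝ x θ)) (‖x‖ ^ 2)) = J
  generalize (∫ y : ℝ × EuclideanSpace ℝ (Fin (p - 1)), (Set.Ico (b ^ 2 / 4) (b ^ 2)).indicator
    (fun r => lossKernel (b ^ 2) r (‖θ‖ * y.1)) (y.1 ^ 2 + ‖y.2‖ ^ 2)) = I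
  linear_combination (-(2 * Real.pi) ^ (-(p : ℝ) / 2) * ‖θ‖ ^ (((p : ℝ) + 1) / 2) *
    Real.exp (-(b * ‖θ‖)) * (I + J)) * he

end Risk

theorem mainTheorem3 (p : ℕ) (hp : 3 ≤ p) :
    -- both risks are finite at every mean vector
    (∀ θ : EuclideanSpace ℝ (Fin p),
      Integrable (fun x => quadLoss θ (jamesStein p x))
          (multivariateGaussian θ (1 : Matrix (Fin p) (Fin p) ℝ)) ∧
        Integrable (fun x => quadLoss θ (jamesSteinPos p x))
          (multivariateGaussian θ (1 : Matrix (Fin p) (Fin p) ℝ))) ∧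
    -- the limit as `‖θ‖ ^ 2` tends to infinity, uniformly in the direction of `θ`
    Tendsto
      (fun θ : EuclideanSpace ℝ (Fin p) =>
        (‖θ‖ ^ 2) ^ (((p : ℝ) + 1) / 4) * Real.exp (‖θ‖ ^ 2 / 2)
            / Real.exp (Real.sqrt (‖θ‖ ^ 2) * Real.sqrt ((p : ℝ) - 2))
          * (quadRisk θ (jamesStein p) - quadRisk θ (jamesSteinPos p)))
      (comap (fun θ : EuclideanSpace ℝ (Fin p) => ‖θ‖ ^ 2) atTop)
      (𝓝 (4 * (((p : ℝ) - 2) ^ (((p : ℝ) - 1) / 4)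
        / (Real.sqrt (2 * Real.pi) * Real.exp ((p : ℝ) / 2 - 1))))) := by
  refine ⟨fun θ => ⟨integrable_quadLoss_jamesStein hp θ, integrable_quadLoss_jamesSteinPos hp θ⟩,
    ?_⟩
  have hpp : (0 : ℝ) < (p : ℝ) - 2 := by
    have : (3 : ℝ) ≤ p := by exact_mod_cast hp
    linarith
  set a : ℝ := (p : ℝ) - 2 with ha
  have hb : 0 < √a := Real.sqrt_pos.2 hpp
  have hb2 : √a ^ 2 = a := Real.sq_sqrt hpp.le
  have hfilter : Tendsto (fun θ : EuclideanSpace ℝ (Fin p) => ‖θ‖)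
      (comap (fun θ : EuclideanSpace ℝ (Fin p) => ‖θ‖ ^ 2) atTop) atTop := by
    refine (Real.tendsto_sqrt_atTop.comp tendsto_comap).congr fun θ => ?_
    simp [Real.sqrt_sq]
  have h := (tendsto_risk_difference hp hb hb2).mono_left hfilter.le_comap
  have hconst : (2 * Real.pi) ^ (-(p : ℝ) / 2) *
      (4 * Real.exp (-√a ^ 2 / 2) * (2 * Real.pi * √a) ^ (((p : ℝ) - 1) / 2)) =
      4 * (a ^ (((p : ℝ) - 1) / 4) / (√(2 * Real.pi) * Real.exp ((p : ℝ) / 2 - 1))) := by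
    have h1 : √a ^ (((p : ℝ) - 1) / 2) = a ^ (((p : ℝ) - 1) / 4) := by
      rw [Real.sqrt_eq_rpow, ← Real.rpow_mul hpp.le]
      congr 1
      ring
    -- The `p - 1` transverse Gaussian integrals cancel all but one factor `√(2π)` of the density's
    -- normalisation.
    have h2 : (2 * Real.pi) ^ (-(p : ℝ) / 2) * (2 * Real.pi) ^ (((p : ℝ) - 1) / 2) =
        (√(2 * Real.pi))⁻¹ := by
      rw [← Real.rpow_add (by positivity), Real.sqrt_eq_rpow, ← Real.rpow_neg (by positivity)]
      congr 1
      ring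
    have h3 : Real.exp (-√a ^ 2 / 2) = (Real.exp ((p : ℝ) / 2 - 1))⁻¹ := by
      rw [← Real.exp_neg, hb2, ha]
      congr 1
      ring
    rw [Real.mul_rpow (by positivity) hb.le, h1, h3, div_eq_mul_inv (a ^ _), mul_inv, ← h2]
    ring
  rw [hconst] at h
  refine h.congr fun θ => ?_
  rw [Real.sqrt_sq (norm_nonneg θ), ← Real.rpow_natCast ‖θ‖ 2, ← Real.rpow_mul (norm_nonneg θ),
    Real.exp_neg, mul_comm (√a)]
  rw [show ((2 : ℕ) : ℝ) * (((p : ℝ) + 1) / 4) = ((p : ℝ) + 1) / 2 by push_cast; ring]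
  ring
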